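/- Let $q$ be a prime power, let $m$ be a positive divisor of $q+1$ with $m\neq q+1$, and let $Y\subseteq\mathbb{P}^2$ be the projective plane curve over $\mathbb{F}_{q^2}$ with affine equation $y^q+y=x^m$, so that $P_\infty=(1:0:0)$ is its only point at infinity. Let $\pi\colon C\to Y$ be the normalization of $Y$, and put $B:=Y(\mathbb{F}_{q^2})\setminus\{P_\infty\}$. For an integer $d>0$, let the complete code $\mathcal{C}(d)$ be the linear code over $\mathbb{F}_{q^2}$ obtained by evaluating the functions in $H^0(C,\pi^*(\mathcal{O}_Y(d)))$ at the points of $\pi^{-1}(B)$; here a section $s$ of $\pi^*(\mathcal{O}_Y(d))$ is identified with the rational function $s/z^d$ on $C$, where $z=0$ is the line at infinity. Assume $d\le m-2$. Then the minimum distance of the dual code $\mathcal{C}(d)^\perp$ is exactly $d+2$. Moreover, the support of every minimum-weight codeword of $\mathcal{C}(d)^\perp$ consists of $d+2$ points of $\pi^{-1}(B)$ whose images under $\pi$ are collinear, i.e. lie on a common line of $\mathbb{P}^2$. -/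

import Mathlib

open Polynomial
open scoped LinearAlgebra.Projectivization

/-- The numerical data of a plane quotient `Y : y^q + y = x^m` of the Hermitian curve over a field
`k` with `q^2` elements: `m` is a divisor of `q + 1` different from `q + 1`.
(Since `k` is a finite field, `card_eq` forces `q` to be a prime power.) -/
structure HermitianQuotient (k : Type*) [Field k] [Fintype k] where
  q : ℕ
  m : ℕ
  card_eq : Fintype.card k = q ^ 2
  dvd : m ∣ q + 1
  ne : m ≠ q + 1

namespace HermitianQuotient

variable {k : Type*} [Field k] [Fintype k] (H : HermitianQuotient k)

lemma two_le_q : 2 ≤ H.q := by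
  have h := Fintype.one_lt_card (α := k)
  rw [H.card_eq] at h
  by_contra hq
  have : H.q ≤ 1 := by omega
  nlinarith

lemma m_pos : 0 < H.m := Nat.pos_of_dvd_of_pos H.dvd (Nat.succ_pos _)

lemma m_lt : H.m < H.q := by
  have h1 := Nat.le_of_dvd (Nat.succ_pos _) H.dvd
  have h2 := H.ne
  have h3 := H.two_le_q
  refine lt_of_le_of_ne (by omega) fun h => ?_
  have h4 := H.dvd
  rw [h] at h4
  have h5 := Nat.le_of_dvd one_pos ((Nat.dvd_add_right (dvd_refl H.q)).mp h4)
  omega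

lemma q_cast : (H.q : k) = 0 := by
  have h := FiniteField.cast_card_eq_zero k
  rw [H.card_eq] at h
  push_cast at h
  exact pow_eq_zero_iff (two_ne_zero) |>.mp h

/-! ### The function field -/

/-- The affine equation of `Y`, as the polynomial `x^m - (y^q + y)` in `k[y][x]`
(inner variable `y`, outer variable `x`). -/
noncomputable def affinePoly : k[X][X] := X ^ H.m - C (X ^ H.q + X)

lemma affinePoly_prime : Prime H.affinePoly := by
  have hm := H.m_pos
  have hq := H.two_le_q
  have hdeg : H.affinePoly.natDegree = H.m := natDegree_X_pow_sub_C
  have hmonic : H.affinePoly.Monic := monic_X_pow_sub_C _ hm.ne'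
  refine Irreducible.prime (irreducible_of_eisenstein_criterion
    (P := Ideal.span {(X : k[X])}) ?_ ?_ ?_ ?_ ?_ hmonic.isPrimitive)
  · exact (Ideal.span_singleton_prime X_ne_zero).2 prime_X
  · rw [hmonic.leadingCoeff, Ideal.mem_span_singleton]
    exact prime_X.not_dvd_one
  · intro n hn
    rw [degree_eq_natDegree hmonic.ne_zero, hdeg] at hn
    have hn' : n < H.m := by exact_mod_cast hn
    rw [Ideal.mem_span_singleton, affinePoly, coeff_sub, coeff_X_pow, if_neg hn'.ne, coeff_C]
    split_ifs
    · rw [zero_sub, dvd_neg]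
      exact dvd_add (dvd_pow_self _ (by omega)) dvd_rfl
    · simp
  · rw [degree_eq_natDegree hmonic.ne_zero, hdeg]
    exact_mod_cast hm
  · rw [Ideal.span_singleton_pow, Ideal.mem_span_singleton, affinePoly, coeff_sub, coeff_X_pow,
      if_neg hm.ne, coeff_C_zero, zero_sub, dvd_neg, X_pow_dvd_iff]
    intro h
    have := h 1 (by norm_num)
    rw [coeff_add, coeff_X_pow, if_neg (by omega), coeff_X_one] at this
    simp at this

/-- The coordinate ring `k[x, y] / (y^q + y - x^m)` of the affine part of `Y`. -/
abbrev CoordRing : Type _ := AdjoinRoot H.affinePoly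

instance : IsDomain H.CoordRing := AdjoinRoot.isDomain_of_prime H.affinePoly_prime

/-- The function field `k(Y) = k(C)`, where `C` is the normalization of `Y`. -/
abbrev FunField : Type _ := FractionRing H.CoordRing

/-- The coordinate functions `x` and `y` on the affine part of `Y`. -/
noncomputable def xA : H.CoordRing := AdjoinRoot.root H.affinePoly

noncomputable def yA : H.CoordRing := AdjoinRoot.of H.affinePoly X

/-- The same functions as elements of the function field. -/
noncomputable def x : H.FunField := algebraMap H.CoordRing H.FunField H.xA

noncomputable def y : H.FunField := algebraMap H.CoordRing H.FunField H.yA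

/-! ### The curve `Y` in the projective plane -/

/-- The projective plane over `k`, with homogeneous coordinates `(x : y : z)`. -/
abbrev Plane (k : Type*) [Field k] : Type _ := ℙ k (Fin 3 → k)

/-- `Y(k)`: the rational points of the projective closure
`y^q + y z^(q-1) = x^m z^(q-m)` of the affine curve (the hypotheses on `m` give `m < q`). -/
def rationalPoints : Set (Plane k) :=
  {P | P.rep 1 ^ H.q + P.rep 1 * P.rep 2 ^ (H.q - 1) = P.rep 0 ^ H.m * P.rep 2 ^ (H.q - H.m)}

/-- The point at infinity `(1 : 0 : 0)`. -/
noncomputable def PInf (k : Type*) [Field k] : Plane k :=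
  Projectivization.mk k ![1, 0, 0] (fun h => one_ne_zero (congrFun h 0))

/-- `B = Y(k) ∖ {P_∞}`. -/
noncomputable def B : Set (Plane k) := H.rationalPoints \ {PInf k}

/-! ### The normalization `π : C → Y` -/

/-- The (closed) points of the nonsingular projective curve `C`: the nontrivial valuation rings
of the function field which contain the constants. The valuation ring is the local ring of `C`
at the point. -/
def CPoint : Type _ :=
  {V : ValuationSubring H.FunField // (∀ c : k, algebraMap k H.FunField c ∈ V) ∧ V ≠ ⊤}

variable {H} in
/-- `f(V) = c`: the function `f` is regular at the point `V` of `C` and has the value `c ∈ k`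
there, i.e. `f - c` lies in the maximal ideal of the local ring at `V`. -/
def CPoint.HasValue (V : H.CPoint) (f : H.FunField) (c : k) : Prop :=
  V.1.valuation (f - algebraMap k H.FunField c) < 1

variable {H} in
/-- `π(V) = P`, where `π : C → Y ⊆ ℙ²` is given by `(x : y : 1)`: after multiplication by a
suitable nonzero function `t`, the coordinates of `(t x : t y : t)` are regular at `V` and have the
homogeneous coordinates of `P` as their values. -/
def CPoint.MapsTo (V : H.CPoint) (P : Plane k) : Prop :=
  ∃ t : H.FunField, t ≠ 0 ∧ ∀ i : Fin 3, V.HasValue (t * ![H.x, H.y, 1] i) (P.rep i)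

/-- `π⁻¹(B)`, the set of points of `C` at which functions are evaluated. -/
def evalPoints : Set H.CPoint := {V | ∃ P ∈ H.B, V.MapsTo P}

/-! ### `π⁻¹(B)` is finite -/

lemma curve_eq : H.yA ^ H.q + H.yA = H.xA ^ H.m := by
  have h := AdjoinRoot.eval₂_root H.affinePoly
  have h' : ∀ F : k[X][X], F = X ^ H.m - C (X ^ H.q + X) →
      eval₂ (AdjoinRoot.of H.affinePoly) (AdjoinRoot.root H.affinePoly) F =
        H.xA ^ H.m - (H.yA ^ H.q + H.yA) := by
    rintro F rfl
    rw [eval₂_sub, eval₂_pow, eval₂_X, eval₂_C, RingHom.map_add, RingHom.map_pow]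
    rfl
  rw [h' H.affinePoly rfl] at h
  exact (sub_eq_zero.mp h).symm

/-- Evaluation of regular functions at an affine rational point of `Y`. -/
noncomputable def evalHom (a b : k) (hab : b ^ H.q + b = a ^ H.m) : H.CoordRing →+* k :=
  AdjoinRoot.lift (evalRingHom b) a (by
    rw [affinePoly, eval₂_sub, eval₂_pow, eval₂_X, eval₂_C]
    simp [hab])

lemma sub_evalHom_mem (a b : k) (hab : b ^ H.q + b = a ^ H.m) (g : H.CoordRing) :
    g - algebraMap k H.CoordRing (H.evalHom a b hab g) ∈
      Ideal.span {H.xA - algebraMap k H.CoordRing a, H.yA - algebraMap k H.CoordRing b} := by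
  set I : Ideal H.CoordRing :=
    Ideal.span {H.xA - algebraMap k H.CoordRing a, H.yA - algebraMap k H.CoordRing b}
  have hx : H.xA - algebraMap k H.CoordRing a ∈ I := Ideal.subset_span (by simp)
  have hy : H.yA - algebraMap k H.CoordRing b ∈ I := Ideal.subset_span (by simp)
  have hC : ∀ c : k, AdjoinRoot.of H.affinePoly (C c) = algebraMap k H.CoordRing c := fun c => rfl
  have key : (Ideal.Quotient.mk I) =
      ((Ideal.Quotient.mk I).comp (algebraMap k H.CoordRing)).comp (H.evalHom a b hab) := by
    apply AdjoinRoot.ringHom_ext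
    · apply Polynomial.ringHom_ext
      · intro c
        simp only [RingHom.comp_apply, evalHom, AdjoinRoot.lift_of, coe_evalRingHom, eval_C]
        rw [hC]
      · simp only [RingHom.comp_apply, evalHom, AdjoinRoot.lift_of, coe_evalRingHom, eval_X]
        exact Ideal.Quotient.eq.mpr hy
    · simp only [RingHom.comp_apply, evalHom, AdjoinRoot.lift_root]
      exact Ideal.Quotient.eq.mpr hx
  exact Ideal.Quotient.eq.mp (congrArg (fun φ => φ g) key)

lemma evalHom_algebraMap (a b : k) (hab : b ^ H.q + b = a ^ H.m) (c : k) :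
    H.evalHom a b hab (algebraMap k H.CoordRing c) = c := by
  change H.evalHom a b hab (AdjoinRoot.of H.affinePoly (C c)) = c
  simp [evalHom]

/-- The local ring of `Y` at an affine rational point is a valuation ring: every function is
regular there, or its inverse is. -/
lemma exists_fraction (a b : k) (hab : b ^ H.q + b = a ^ H.m) (f : H.FunField) :
    ∃ g h : H.CoordRing, H.evalHom a b hab h ≠ 0 ∧
      (f = algebraMap _ H.FunField g / algebraMap _ H.FunField h ∨
        f⁻¹ = algebraMap _ H.FunField g / algebraMap _ H.FunField h) := by
  set p : Ideal H.CoordRing := RingHom.ker (H.evalHom a b hab) with hp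
  have hpp : p.IsPrime := RingHom.ker_isPrime _
  let R := Localization.AtPrime p
  have hle : p.primeCompl ≤ nonZeroDivisors H.CoordRing := p.primeCompl_le_nonZeroDivisors
  have : IsDomain R := IsLocalization.isDomain_localization hle
  let : Algebra R H.FunField := IsLocalization.localizationAlgebraOfSubmonoidLe R H.FunField
    p.primeCompl (nonZeroDivisors H.CoordRing) hle
  have : IsScalarTower H.CoordRing R H.FunField :=
    IsLocalization.localization_isScalarTower_of_submonoid_le R H.FunField p.primeCompl
      (nonZeroDivisors H.CoordRing) hle
  have : IsFractionRing R H.FunField :=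
    IsFractionRing.isFractionRing_of_isDomain_of_isLocalization p.primeCompl R H.FunField
  have : IsNoetherianRing R := IsLocalization.isNoetherianRing p.primeCompl R inferInstance
  have hI : p = Ideal.span
      {H.xA - algebraMap k H.CoordRing a, H.yA - algebraMap k H.CoordRing b} := by
    apply le_antisymm
    · intro g hg
      have := H.sub_evalHom_mem a b hab g
      rwa [(RingHom.mem_ker).mp hg, map_zero, sub_zero] at this
    · rw [Ideal.span_le]
      rintro g (rfl | rfl)
      · have h1 : H.evalHom a b hab H.xA = a := by simp [xA, evalHom]
        exact RingHom.mem_ker.mpr (by rw [map_sub, h1, evalHom_algebraMap, sub_self])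
      · have h1 : H.evalHom a b hab H.yA = b := by simp [yA, evalHom]
        exact RingHom.mem_ker.mpr (by rw [map_sub, h1, evalHom_algebraMap, sub_self])
  -- the maximal ideal is generated by `x - a`
  have hprinc : (IsLocalRing.maximalIdeal R).IsPrincipal := by
    refine ⟨⟨algebraMap H.CoordRing R (H.xA - algebraMap k H.CoordRing a), ?_⟩⟩
    have hmap : IsLocalRing.maximalIdeal R = Ideal.span
        {algebraMap H.CoordRing R (H.xA - algebraMap k H.CoordRing a),
          algebraMap H.CoordRing R (H.yA - algebraMap k H.CoordRing b)} := by
      rw [← IsLocalization.AtPrime.map_eq_maximalIdeal p R, ← Set.image_pair, ← Ideal.map_span]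
      exact congrArg _ hI
    rw [hmap]
    apply le_antisymm
    · rw [Ideal.span_le]
      rintro r (rfl | rfl)
      · exact Submodule.mem_span_singleton_self _
      · -- `(y - b) * (S + 1) = (x - a) * T` and `S + 1` does not vanish at `(a, b)`
        set α := algebraMap k H.CoordRing a
        set β := algebraMap k H.CoordRing b
        set S := ∑ i ∈ Finset.range H.q, H.yA ^ i * β ^ (H.q - 1 - i) with hS
        set T := ∑ i ∈ Finset.range H.m, H.xA ^ i * α ^ (H.m - 1 - i)
        have e1 : S * (H.yA - β) = H.yA ^ H.q - β ^ H.q := geom_sum₂_mul _ _ _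
        have e2 : T * (H.xA - α) = H.xA ^ H.m - α ^ H.m := geom_sum₂_mul _ _ _
        have e3 : β ^ H.q + β = α ^ H.m := by
          rw [← map_pow, ← map_add, hab, map_pow]
        have e4 : (S + 1) * (H.yA - β) = T * (H.xA - α) := by
          linear_combination e1 - e2 + H.curve_eq - e3
        have hS0 : H.evalHom a b hab S = 0 := by
          have hy : H.evalHom a b hab H.yA = b := by simp [yA, evalHom]
          rw [hS, map_sum]
          simp only [map_mul, map_pow, hy, β, evalHom_algebraMap]
          rw [geom_sum₂_self, H.q_cast, zero_mul]
        have hu : IsUnit (algebraMap H.CoordRing R (S + 1)) :=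
          IsLocalization.map_units R (⟨S + 1, by
            rw [Ideal.mem_primeCompl_iff, hp, RingHom.mem_ker, map_add, hS0, map_one, zero_add]
            exact one_ne_zero⟩ : p.primeCompl)
        obtain ⟨u, hu⟩ := hu
        refine Ideal.mem_span_singleton'.mpr ⟨↑u⁻¹ * algebraMap H.CoordRing R T, ?_⟩
        rw [mul_assoc, ← map_mul, ← e4, map_mul, ← hu, Units.inv_mul_cancel_left]
    · exact Ideal.span_mono (by simp)
  have hV : ValuationRing R :=
    ((tfae_of_isNoetherianRing_of_isLocalRing_of_isDomain R).out 4 1).mp hprinc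
  rcases ValuationRing.isInteger_or_isInteger R f with ⟨r, hr⟩ | ⟨r, hr⟩
  all_goals
    obtain ⟨g, s, rfl⟩ := IsLocalization.exists_mk'_eq p.primeCompl r
    refine ⟨g, s, s.2, ?_⟩
    rw [← hr]
    have hs : algebraMap H.CoordRing H.FunField s ≠ 0 := fun h0 => by
      have : (s : H.CoordRing) = 0 :=
        (map_eq_zero_iff _ (IsFractionRing.injective H.CoordRing H.FunField)).mp h0
      exact s.2 (this ▸ p.zero_mem)
    have key : algebraMap R H.FunField (IsLocalization.mk' R g s) =
        algebraMap _ H.FunField g / algebraMap _ H.FunField (s : H.CoordRing) := by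
      rw [eq_div_iff hs, IsScalarTower.algebraMap_apply H.CoordRing R H.FunField s, ← map_mul,
        IsLocalization.mk'_spec, ← IsScalarTower.algebraMap_apply]
  · exact Or.inl key
  · exact Or.inr key

variable {H} in
lemma CPoint.valuation_const (V : H.CPoint) {c : k} (hc : c ≠ 0) :
    V.1.valuation (algebraMap k H.FunField c) = 1 := by
  have h1 := (V.1.valuation_le_one_iff _).mpr (V.2.1 c)
  have h2 := (V.1.valuation_le_one_iff _).mpr (V.2.1 c⁻¹)
  refine le_antisymm h1 ?_
  by_contra h
  have h3 : V.1.valuation (algebraMap k H.FunField c * algebraMap k H.FunField c⁻¹) < 1 := by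
    rw [map_mul]
    exact mul_lt_one_of_lt_of_le (not_le.mp h) h2
  rw [← map_mul, mul_inv_cancel₀ hc, map_one, map_one] at h3
  exact lt_irrefl _ h3

variable {H} in
/-- The local ring of `C` at a point over an affine rational point of `Y` is the local ring of
`Y` at that point. -/
lemma CPoint.mem_iff (V : H.CPoint) (a b : k) (hab : b ^ H.q + b = a ^ H.m)
    (hx : V.HasValue H.x a) (hy : V.HasValue H.y b) (f : H.FunField) :
    f ∈ V.1 ↔ ∃ g h : H.CoordRing, H.evalHom a b hab h ≠ 0 ∧
      f = algebraMap _ H.FunField g / algebraMap _ H.FunField h := by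
  have hconst : ∀ c : k, algebraMap H.CoordRing H.FunField (algebraMap k H.CoordRing c) =
      algebraMap k H.FunField c := fun c =>
    (IsScalarTower.algebraMap_apply k H.CoordRing H.FunField c).symm
  have hreg : ∀ g : H.CoordRing, V.1.valuation (algebraMap _ H.FunField g) ≤ 1 := by
    have hx1 : H.x ∈ V.1 := by
      have := V.1.add_mem _ _ ((V.1.valuation_le_one_iff _).mp hx.le) (V.2.1 a)
      rwa [sub_add_cancel] at this
    have hy1 : H.y ∈ V.1 := by
      have := V.1.add_mem _ _ ((V.1.valuation_le_one_iff _).mp hy.le) (V.2.1 b)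
      rwa [sub_add_cancel] at this
    intro g
    rw [V.1.valuation_le_one_iff]
    induction g using AdjoinRoot.induction_on with
    | ih F =>
      induction F using Polynomial.induction_on' with
      | add F G hF hG => rw [map_add, map_add]; exact V.1.add_mem _ _ hF hG
      | monomial n F =>
        rw [← C_mul_X_pow_eq_monomial, map_mul, map_mul, map_pow, map_pow]
        refine V.1.mul_mem _ _ ?_ (pow_mem hx1 n)
        induction F using Polynomial.induction_on' with
        | add F G hF hG => rw [map_add, map_add, map_add]; exact V.1.add_mem _ _ hF hG
        | monomial n c =>
          rw [← C_mul_X_pow_eq_monomial, map_mul, map_mul, map_mul, map_pow, map_pow, map_pow]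
          exact V.1.mul_mem _ _ (hconst c ▸ V.2.1 c) (pow_mem hy1 n)
  have hmax : ∀ g : H.CoordRing,
      V.HasValue (algebraMap _ H.FunField g) (H.evalHom a b hab g) := by
    intro g
    obtain ⟨u, v, huv⟩ := Ideal.mem_span_pair.mp (H.sub_evalHom_mem a b hab g)
    unfold CPoint.HasValue
    rw [← hconst, ← map_sub, ← huv, map_add, map_mul, map_mul, map_sub, map_sub, hconst, hconst]
    refine Valuation.map_add_lt _ ?_ ?_
    · rw [map_mul]; exact mul_lt_one_of_nonneg_of_lt_one_right (hreg u) zero_le hx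
    · rw [map_mul]; exact mul_lt_one_of_nonneg_of_lt_one_right (hreg v) zero_le hy
  have hunit : ∀ h : H.CoordRing, H.evalHom a b hab h ≠ 0 →
      V.1.valuation (algebraMap _ H.FunField h) = 1 := by
    intro h hh
    have h1 := hmax h
    unfold CPoint.HasValue at h1
    rw [← V.valuation_const hh] at h1 ⊢
    exact Valuation.map_eq_of_sub_lt _ h1
  constructor
  · intro hf
    by_cases hf0 : f = 0
    · exact ⟨0, 1, by simp, by simp [hf0]⟩
    obtain ⟨g, h, hh, e | e⟩ := H.exists_fraction a b hab f
    · exact ⟨g, h, hh, e⟩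
    · by_cases hg : H.evalHom a b hab g = 0
      · exfalso
        have h1 := hmax g
        unfold CPoint.HasValue at h1
        rw [hg, map_zero, sub_zero] at h1
        have h2 : V.1.valuation f⁻¹ < 1 := by
          rw [e, map_div₀, hunit h hh, div_one]; exact h1
        have h3 : V.1.valuation (f * f⁻¹) < 1 := by
          rw [map_mul]
          exact mul_lt_one_of_nonneg_of_lt_one_right ((V.1.valuation_le_one_iff _).mpr hf) zero_le h2
        rw [mul_inv_cancel₀ hf0, map_one] at h3
        exact lt_irrefl _ h3
      · exact ⟨h, g, hg, by rw [← inv_inv f, e, inv_div]⟩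
  · rintro ⟨g, h, hh, rfl⟩
    rw [← V.1.valuation_le_one_iff, map_div₀, hunit h hh, div_one]
    exact hreg g

variable {H} in
/-- A point of `C` over a point of `B` has rational affine coordinates. -/
lemma CPoint.exists_coords (V : H.CPoint) {P : Plane k} (hP : P ∈ H.B) (hV : V.MapsTo P) :
    ∃ a b : k, b ^ H.q + b = a ^ H.m ∧ V.HasValue H.x a ∧ V.HasValue H.y b := by
  obtain ⟨hY, hinf⟩ := hP
  obtain ⟨t, -, ht⟩ := hV
  have hq := H.two_le_q
  have hmq := H.m_lt
  change _ = _ at hY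
  have h2 : P.rep 2 ≠ 0 := by
    intro h2
    rw [h2, zero_pow (by omega), zero_pow (by omega), mul_zero, mul_zero, add_zero] at hY
    have h1 : P.rep 1 = 0 := pow_eq_zero_iff (by omega) |>.mp hY
    apply hinf
    rw [Set.mem_singleton_iff, PInf, ← P.mk_rep, Projectivization.mk_eq_mk_iff']
    refine ⟨P.rep 0, ?_⟩
    ext i
    fin_cases i <;> simp [h1, h2]
  have ht2 : V.1.valuation t = 1 := by
    have := ht 2
    unfold CPoint.HasValue at this
    rw [← V.valuation_const h2] at this ⊢
    simpa using Valuation.map_eq_of_sub_lt _ this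
  have aux : ∀ (f : H.FunField) (c : k), V.HasValue (t * f) c →
      V.HasValue f (c / P.rep 2) := by
    intro f c hc
    have hc2 := V.1.valuation_le_one_iff _ |>.mpr (V.2.1 (c / P.rep 2))
    have h3 : V.1.valuation (t - algebraMap k H.FunField (P.rep 2)) < 1 := by
      simpa [CPoint.HasValue] using ht 2
    have e : t * (f - algebraMap k H.FunField (c / P.rep 2)) =
        (t * f - algebraMap k H.FunField c) - algebraMap k H.FunField (c / P.rep 2) *
          (t - algebraMap k H.FunField (P.rep 2)) := by
      have : algebraMap k H.FunField c =
          algebraMap k H.FunField (c / P.rep 2) * algebraMap k H.FunField (P.rep 2) := by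
        rw [← map_mul, div_mul_cancel₀ _ h2]
      rw [this]; ring
    have h4 : V.1.valuation (t * (f - algebraMap k H.FunField (c / P.rep 2))) < 1 := by
      rw [e]
      refine Valuation.map_sub_lt _ hc ?_
      rw [map_mul]
      exact mul_lt_one_of_nonneg_of_lt_one_right hc2 zero_le h3
    rwa [map_mul, ht2, one_mul] at h4
  refine ⟨P.rep 0 / P.rep 2, P.rep 1 / P.rep 2, ?_, aux _ _ (ht 0), aux _ _ (ht 1)⟩
  have e1 : P.rep 2 ^ H.q = P.rep 2 ^ (H.q - 1) * P.rep 2 := by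
    rw [← pow_succ]; congr 1; omega
  have e2 : P.rep 2 ^ H.q = P.rep 2 ^ (H.q - H.m) * P.rep 2 ^ H.m := by
    rw [← pow_add]; congr 1; omega
  have hz : P.rep 2 ^ H.q ≠ 0 := pow_ne_zero _ h2
  apply mul_right_cancel₀ hz
  have e3 : P.rep 1 / P.rep 2 * P.rep 2 ^ H.q = P.rep 1 * P.rep 2 ^ (H.q - 1) := by
    rw [e1]; field_simp
  have e4 : P.rep 0 ^ H.m / P.rep 2 ^ H.m * P.rep 2 ^ H.q =
      P.rep 0 ^ H.m * P.rep 2 ^ (H.q - H.m) := by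
    rw [e2]; field_simp
  rw [add_mul, div_pow, div_mul_cancel₀ _ hz, e3, div_pow, e4, hY]

instance : Finite H.evalPoints := by
  choose a b hab hx hy using fun V : H.evalPoints =>
    V.1.exists_coords V.2.choose_spec.1 V.2.choose_spec.2
  refine Finite.of_injective (fun V => (a V, b V)) fun V W h => ?_
  obtain ⟨ha, hb⟩ := Prod.mk.inj h
  apply Subtype.ext
  apply Subtype.ext
  ext f
  rw [V.1.mem_iff _ _ (hab V) (hx V) (hy V), W.1.mem_iff _ _ (hab W) (hx W) (hy W)]
  simp only [ha, hb]

noncomputable instance : Fintype H.evalPoints := Fintype.ofFinite _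

/-! ### The complete code `C(d)` -/

variable {H} in
/-- The stalk at `V` of the invertible sheaf `π^*(O_Y(d))`, embedded in the function field through
division by `z^d`: since `O_Y(d)` is generated by the monomials of degree `d` in the homogeneous
coordinates, the stalk is generated over the local ring at `V` by the functions `x^i y^j` with
`i + j ≤ d`. -/
noncomputable def CPoint.stalk (V : H.CPoint) (d : ℕ) : Submodule V.1 H.FunField :=
  Submodule.span V.1 {g | ∃ i j : ℕ, i + j ≤ d ∧ g = H.x ^ i * H.y ^ j}

/-- The space of global sections `H⁰(C, π^*(O_Y(d)))`. -/
noncomputable def globalSections (d : ℕ) : Submodule k H.FunField where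
  carrier := {f | ∀ V : H.CPoint, f ∈ V.stalk d}
  add_mem' hf hg V := add_mem (hf V) (hg V)
  zero_mem' V := zero_mem _
  smul_mem' c f hf V := by
    rw [Algebra.smul_def]
    exact (V.stalk d).smul_mem (⟨algebraMap k H.FunField c, V.2.1 c⟩ : V.1) (hf V)

/-- The complete code `C(d)`: the words obtained by evaluating the global sections of
`π^*(O_Y(d))` at all the points of `π⁻¹(B)`. -/
noncomputable def completeCode (d : ℕ) : Submodule k (H.evalPoints → k) where
  carrier := {w | ∃ f ∈ H.globalSections d, ∀ V : H.evalPoints, V.1.HasValue f (w V)}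
  add_mem' := by
    rintro w w' ⟨f, hf, h⟩ ⟨f', hf', h'⟩
    refine ⟨f + f', add_mem hf hf', fun V => ?_⟩
    have := Valuation.map_add_lt _ (h V) (h' V)
    unfold CPoint.HasValue
    rwa [Pi.add_apply, map_add, add_sub_add_comm]
  zero_mem' := ⟨0, zero_mem _, fun V => by simp [CPoint.HasValue]⟩
  smul_mem' := by
    rintro c w ⟨f, hf, h⟩
    refine ⟨c • f, Submodule.smul_mem _ c hf, fun V => ?_⟩
    unfold CPoint.HasValue
    rw [Pi.smul_apply, smul_eq_mul, map_mul, Algebra.smul_def, ← mul_sub, map_mul]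
    exact mul_lt_one_of_nonneg_of_lt_one_right
      ((V.1.1.valuation_le_one_iff _).mpr (V.1.2.1 c)) zero_le (h V)

end HermitianQuotient

/-! ### Linear codes -/

section Codes

variable {k ι : Type*} [Field k] [Fintype ι]

/-- The dual of a linear code with respect to the standard bilinear form. -/
def dualCode (D : Submodule k (ι → k)) : Submodule k (ι → k) where
  carrier := {w | ∀ c ∈ D, w ⬝ᵥ c = 0}
  add_mem' hv hw c hc := by rw [add_dotProduct, hv c hc, hw c hc, add_zero]
  zero_mem' c _ := zero_dotProduct c
  smul_mem' a w hw c hc := by rw [smul_dotProduct, hw c hc, smul_zero]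

/-- `D` has minimum distance `n`: the least Hamming distance of two distinct codewords exists and
is equal to `n`. -/
def HasMinDistance [DecidableEq k] (D : Submodule k (ι → k)) (n : ℕ) : Prop :=
  IsLeast {l | ∃ v ∈ D, ∃ w ∈ D, v ≠ w ∧ hammingDist v w = l} n

/-- `w` is a minimum-weight codeword of `D`: a nonzero codeword whose Hamming weight is minimal
among all nonzero codewords. -/
def IsMinWeightCodeword [DecidableEq k] (D : Submodule k (ι → k)) (w : ι → k) : Prop :=
  w ∈ D ∧ w ≠ 0 ∧ ∀ v ∈ D, v ≠ 0 → hammingNorm w ≤ hammingNorm v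

end Codes

namespace HermitianQuotient

variable {k : Type*} [Field k] [Fintype k] {H : HermitianQuotient k}

/-! ### Values of functions at points of `C`. -/

namespace CPoint

/-! Evaluation points are determined by their affine coordinates (`CPoint.ext_of_coords`), so the
lower bound is a statement about distinct points of the affine plane. Products of at most `d` affine
forms are sections, hence orthogonal to dual codewords (`dualCode_orthogonal`). If a nonzero
codeword had at most `d + 1` support points, lines through all of them but one, avoiding that one,
would isolate a single nonzero term (`add_two_le_hammingNorm`). With `d + 2` support points, a line
through two of them that misses a third saves one factor and gives the same contradiction; hence
collinearity (`exists_line_of_hammingNorm_eq`).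

For the upper bound, a horizontal line `y = b` with `b^q + b ≠ 0` carries `m ≥ d + 2` rational
points. If every section restricts to it as a polynomial in `x` of degree at most `d`, a kernel
vector of a Vandermonde matrix is a codeword supported on `d + 2` of these points
(`exists_dual_codeword`).

The difficulty is that the code is complete: sections live on the normalization and need not come
from forms of degree `d`. For `d < m` they still have the shape `∑ r_i(y) x^i` with `i ≤ d`
(`exists_polynomial_of_mem_globalSections`). The group of `m`-th roots of unity acts by scaling `x`
and splits a section into pieces `g(y) x^i / p(y)`. Integrality over `k[y]`, with `y^q + y`
squarefree, removes the denominator, and the pole order at infinity forces `i ≤ d`. -/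

lemma HasValue.unique {V : H.CPoint} {f : H.FunField} {a b : k} (ha : V.HasValue f a)
    (hb : V.HasValue f b) : a = b := by
  by_contra hab
  have h := Valuation.map_sub_lt _ hb ha
  rw [sub_sub_sub_cancel_left, ← map_sub, V.valuation_const (sub_ne_zero.mpr hab)] at h
  exact lt_irrefl _ h

lemma hasValue_const (V : H.CPoint) (c : k) : V.HasValue (algebraMap k H.FunField c) c := by
  simp [HasValue]

lemma HasValue.add {V : H.CPoint} {f g : H.FunField} {a b : k} (hf : V.HasValue f a)
    (hg : V.HasValue g b) : V.HasValue (f + g) (a + b) := by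
  have := Valuation.map_add_lt _ hf hg
  unfold HasValue
  rwa [map_add, add_sub_add_comm]

lemma HasValue.le_one {V : H.CPoint} {f : H.FunField} {a : k} (hf : V.HasValue f a) :
    V.1.valuation f ≤ 1 := by
  have := V.1.add_mem _ _ ((V.1.valuation_le_one_iff _).mp hf.le) (V.2.1 a)
  rw [sub_add_cancel] at this
  exact (V.1.valuation_le_one_iff _).mpr this

lemma HasValue.mul {V : H.CPoint} {f g : H.FunField} {a b : k} (hf : V.HasValue f a)
    (hg : V.HasValue g b) : V.HasValue (f * g) (a * b) := by
  have e : f * g - algebraMap k H.FunField (a * b) = f * (g - algebraMap k H.FunField b) +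
      algebraMap k H.FunField b * (f - algebraMap k H.FunField a) := by
    rw [map_mul]; ring
  unfold HasValue
  rw [e]
  refine Valuation.map_add_lt _ ?_ ?_
  · rw [map_mul]
    exact mul_lt_one_of_nonneg_of_lt_one_right hf.le_one zero_le hg
  · rw [map_mul]
    exact mul_lt_one_of_nonneg_of_lt_one_right (V.hasValue_const b).le_one zero_le hf

lemma HasValue.pow {V : H.CPoint} {f : H.FunField} {a : k} (hf : V.HasValue f a) (n : ℕ) :
    V.HasValue (f ^ n) (a ^ n) := by
  induction n with
  | zero => simpa using V.hasValue_const 1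
  | succ n ih => rw [pow_succ, pow_succ]; exact ih.mul hf

lemma HasValue.sum {V : H.CPoint} {ι : Type*} (s : Finset ι) {f : ι → H.FunField} {a : ι → k}
    (h : ∀ i ∈ s, V.HasValue (f i) (a i)) : V.HasValue (∑ i ∈ s, f i) (∑ i ∈ s, a i) := by
  classical
  induction s using Finset.induction_on with
  | empty => simpa using V.hasValue_const 0
  | insert i s hi ih =>
    rw [Finset.sum_insert hi, Finset.sum_insert hi]
    exact (h i (by simp)).add (ih fun j hj => h j (by simp [hj]))

/-- The value of a polynomial in `y`. -/
lemma HasValue.polynomial {V : H.CPoint} {b : k} (hy : V.HasValue H.y b) (p : k[X]) :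
    V.HasValue (algebraMap k[X] H.FunField p) (p.eval b) := by
  induction p using Polynomial.induction_on' with
  | add p r hp hr => rw [map_add, eval_add]; exact hp.add hr
  | monomial n c =>
    rw [← C_mul_X_pow_eq_monomial, map_mul, map_pow, eval_mul, eval_C, eval_pow, eval_X]
    exact (V.hasValue_const c).mul (hy.pow n)

/-- A point of `C` is determined by its affine coordinates. -/
lemma ext_of_coords {V W : H.CPoint} {a b : k} (hab : b ^ H.q + b = a ^ H.m)
    (hVx : V.HasValue H.x a) (hVy : V.HasValue H.y b) (hWx : W.HasValue H.x a)
    (hWy : W.HasValue H.y b) : V = W := by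
  apply Subtype.ext
  ext f
  -- The local ring is described by `(a, b)` alone, since `Y` is already nonsingular at its affine
  -- rational points.
  rw [V.mem_iff _ _ hab hVx hVy, W.mem_iff _ _ hab hWx hWy]

/-- The third coordinate shows that the scaling function itself has value `P.rep 2`; uniqueness of
values gives the rest. -/
lemma MapsTo.rep_eq {V : H.CPoint} {P : Plane k} {a b : k} (hx : V.HasValue H.x a)
    (hy : V.HasValue H.y b) (hP : V.MapsTo P) :
    P.rep 0 = P.rep 2 * a ∧ P.rep 1 = P.rep 2 * b := by
  obtain ⟨t, -, ht⟩ := hP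
  have h2 : V.HasValue t (P.rep 2) := by simpa using ht 2
  exact ⟨(ht 0).unique (h2.mul hx), (ht 1).unique (h2.mul hy)⟩

end CPoint

/-! ### Lifting affine rational points of `Y` to `C`. -/

lemma algebraMap_X : algebraMap k[X] H.FunField X = H.y := rfl

lemma algebraMap_C (c : k) : algebraMap k[X] H.FunField (C c) = algebraMap k H.FunField c := rfl

lemma curve_eq_funField : H.y ^ H.q + H.y = H.x ^ H.m := by
  have := congrArg (algebraMap H.CoordRing H.FunField) H.curve_eq
  simpa [x, y] using this

/-- The equation of `Y` has positive degree in `x`, so it imposes no relation on `y` alone: `y` is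
transcendental over `k`. -/
lemma algebraMap_polynomial_injective :
    Function.Injective (algebraMap k[X] H.FunField) := by
  have h1 : Function.Injective (algebraMap k[X] H.CoordRing) := by
    refine AdjoinRoot.of.injective_of_degree_ne_zero ?_
    rw [affinePoly, degree_X_pow_sub_C H.m_pos]
    exact_mod_cast H.m_pos.ne'
  rw [IsScalarTower.algebraMap_eq k[X] H.CoordRing H.FunField]
  exact (IsFractionRing.injective H.CoordRing H.FunField).comp h1

/-- Every affine rational point of `Y` is the image of a point of `C`. -/
lemma exists_cPoint (a b : k) (hab : b ^ H.q + b = a ^ H.m) :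
    ∃ V : H.CPoint, V.HasValue H.x a ∧ V.HasValue H.y b := by
  set ι := algebraMap H.CoordRing H.FunField with hι
  have hinj : Function.Injective ι := IsFractionRing.injective _ _
  let e : H.CoordRing ≃+* ι.range := RingEquiv.ofBijective ι.rangeRestrict
    ⟨fun u v h => hinj (congrArg Subtype.val h), ι.rangeRestrict_surjective⟩
  let I : Ideal ι.range := RingHom.ker ((H.evalHom a b hab).comp e.symm.toRingHom)
  have hI : I ≠ ⊤ := RingHom.ker_ne_top _
  -- A valuation ring whose nonunits contain the ideal of functions vanishing at `(a, b)`.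
  obtain ⟨W, hW, hIW⟩ := Ideal.image_subset_nonunits_valuationSubring I hI
  have hlt : ∀ g : H.CoordRing, H.evalHom a b hab g = 0 → W.valuation (ι g) < 1 := by
    intro g hg
    rw [← W.mem_nonunits_iff]
    refine hIW ⟨e g, ?_, rfl⟩
    simp [I, RingHom.mem_ker, hg]
  have hx : W.valuation (H.x - algebraMap k H.FunField a) < 1 := by
    have := hlt (H.xA - algebraMap k H.CoordRing a) (by
      rw [map_sub, evalHom_algebraMap]; simp [xA, evalHom])
    rwa [map_sub, hι, ← IsScalarTower.algebraMap_apply] at this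
  have hy : W.valuation (H.y - algebraMap k H.FunField b) < 1 := by
    have := hlt (H.yA - algebraMap k H.CoordRing b) (by
      rw [map_sub, evalHom_algebraMap]; simp [yA, evalHom])
    rwa [map_sub, hι, ← IsScalarTower.algebraMap_apply] at this
  refine ⟨⟨W, fun c => hW ?_, ?_⟩, hx, hy⟩
  · rw [IsScalarTower.algebraMap_apply k H.CoordRing H.FunField]
    exact ⟨_, rfl⟩
  -- The trivial valuation ring is excluded because `y - b` is a nonzero nonunit of `W`.
  · rintro rfl
    have h0 : H.y - algebraMap k H.FunField b ≠ 0 := by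
      rw [← algebraMap_X, ← algebraMap_C, ← map_sub]
      exact (map_ne_zero_iff _ algebraMap_polynomial_injective).mpr (X_sub_C_ne_zero b)
    have h1 : (⊤ : ValuationSubring H.FunField).valuation
        (H.y - algebraMap k H.FunField b)⁻¹ ≤ 1 :=
      (ValuationSubring.valuation_le_one_iff _ _).mpr trivial
    rw [map_inv₀] at h1
    exact absurd hy (not_lt.mpr ((inv_le_one₀
      (zero_lt_iff.mpr ((Valuation.ne_zero_iff _).mpr h0))).mp h1))

/-- Every affine rational point of `Y` is the image of an evaluation point. -/
lemma exists_evalPoint (a b : k) (hab : b ^ H.q + b = a ^ H.m) :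
    ∃ V : H.evalPoints, V.1.HasValue H.x a ∧ V.1.HasValue H.y b := by
  obtain ⟨V, hx, hy⟩ := exists_cPoint a b hab
  have hv : (![a, b, 1] : Fin 3 → k) ≠ 0 := fun h => one_ne_zero (congrFun h 2)
  let P : Plane k := Projectivization.mk k ![a, b, 1] hv
  obtain ⟨u, hu⟩ : ∃ u : kˣ, u • ![a, b, 1] = P.rep := Projectivization.exists_smul_eq_mk_rep k _ hv
  have hu0 : P.rep 0 = u * a := by rw [← hu]; rfl
  have hu1 : P.rep 1 = u * b := by rw [← hu]; rfl
  have hu2 : P.rep 2 = u := by rw [← hu]; exact mul_one _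
  have hq := H.two_le_q
  have hmq := H.m_lt
  refine ⟨⟨V, P, ⟨?_, ?_⟩, algebraMap k H.FunField u, by simp, ?_⟩, hx, hy⟩
  · change _ = _
    rw [hu0, hu1, hu2, mul_pow, mul_pow, ← hab]
    have e1 : (u : k) ^ H.q = u * u ^ (H.q - 1) := by rw [← pow_succ']; congr 1; omega
    have e2 : (u : k) ^ H.q = u ^ H.m * u ^ (H.q - H.m) := by rw [← pow_add]; congr 1; omega
    linear_combination - b * e1 + (b ^ H.q + b) * e2
  · intro h
    obtain ⟨c, hc⟩ := (Projectivization.mk_eq_mk_iff' k _ _ hv _).mp h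
    simpa using congrFun hc 2
  · intro i
    fin_cases i
    · exact hu0 ▸ (V.hasValue_const _).mul hx
    · exact hu1 ▸ (V.hasValue_const _).mul hy
    · have : P.rep 2 = (u : k) * 1 := by rw [hu2, mul_one]
      refine this ▸ (V.hasValue_const _).mul ?_
      simpa using V.hasValue_const 1

/-! ### Affine forms are sections -/

lemma CPoint.stalk_mono (V : H.CPoint) {d e : ℕ} (h : d ≤ e) : V.stalk d ≤ V.stalk e :=
  Submodule.span_mono fun _ ⟨i, j, hij, hg⟩ => ⟨i, j, hij.trans h, hg⟩

lemma CPoint.mul_mem_stalk (V : H.CPoint) {d : ℕ} {c f : H.FunField} (hc : c ∈ V.1)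
    (hf : f ∈ V.stalk d) : c * f ∈ V.stalk d :=
  (V.stalk d).smul_mem (⟨c, hc⟩ : V.1) hf

/-- Scalars appear as elements of the function field, so that motives may involve maps that are not
linear over the local ring, such as `scale`. -/
lemma CPoint.stalk_induction (V : H.CPoint) {d : ℕ} {motive : H.FunField → Prop}
    (mem : ∀ i j, i + j ≤ d → motive (H.x ^ i * H.y ^ j)) (zero : motive 0)
    (add : ∀ f g, motive f → motive g → motive (f + g))
    (mul : ∀ c ∈ V.1, ∀ f, motive f → motive (c * f)) {f : H.FunField} (hf : f ∈ V.stalk d) :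
    motive f := by
  unfold CPoint.stalk at hf
  induction hf using Submodule.span_induction with
  | mem g hg => obtain ⟨i, j, h, rfl⟩ := hg; exact mem i j h
  | zero => exact zero
  | add f g _ _ hf hg => exact add f g hf hg
  | smul c f _ hf => exact mul c c.2 f hf

lemma globalSections_mono {d e : ℕ} (h : d ≤ e) : H.globalSections d ≤ H.globalSections e :=
  fun _ hf V => V.stalk_mono h (hf V)

lemma monomial_mul_mem_globalSections {d e i j : ℕ} (hij : i + j ≤ e) {f : H.FunField}
    (hf : f ∈ H.globalSections d) : H.x ^ i * H.y ^ j * f ∈ H.globalSections (d + e) := by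
  intro V
  refine V.stalk_induction (motive := fun f => H.x ^ i * H.y ^ j * f ∈ V.stalk (d + e))
    (fun i' j' h' => Submodule.subset_span ⟨i + i', j + j', by omega, by ring⟩) ?_ ?_ ?_ (hf V)
  · rw [mul_zero]; exact zero_mem _
  · intro f g hf hg; rw [mul_add]; exact add_mem hf hg
  · intro c hc f hf; rw [mul_left_comm]; exact V.mul_mem_stalk hc hf

lemma one_mem_globalSections (d : ℕ) : (1 : H.FunField) ∈ H.globalSections d :=
  fun _ => Submodule.subset_span ⟨0, 0, by omega, by simp⟩

/-- The affine form `u 0 * x + u 1 * y + u 2`. -/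
noncomputable def affineForm (H : HermitianQuotient k) (u : Fin 3 → k) : H.FunField :=
  algebraMap k H.FunField (u 0) * H.x + algebraMap k H.FunField (u 1) * H.y +
    algebraMap k H.FunField (u 2)

lemma CPoint.HasValue.affineForm {V : H.CPoint} {a b : k} (hx : V.HasValue H.x a)
    (hy : V.HasValue H.y b) (u : Fin 3 → k) :
    V.HasValue (H.affineForm u) (u 0 * a + u 1 * b + u 2) :=
  (((V.hasValue_const _).mul hx).add ((V.hasValue_const _).mul hy)).add (V.hasValue_const _)

lemma affineForm_mul_mem_globalSections (u : Fin 3 → k) {d : ℕ} {f : H.FunField}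
    (hf : f ∈ H.globalSections d) : H.affineForm u * f ∈ H.globalSections (d + 1) := by
  have e : H.affineForm u * f = u 0 • (H.x ^ 1 * H.y ^ 0 * f) + u 1 • (H.x ^ 0 * H.y ^ 1 * f) +
      u 2 • (H.x ^ 0 * H.y ^ 0 * f) := by
    simp only [affineForm, Algebra.smul_def]; ring
  rw [e]
  refine add_mem (add_mem ?_ ?_) ?_ <;>
    exact Submodule.smul_mem _ _ (monomial_mul_mem_globalSections (by simp) hf)

lemma prod_affineForm_mem_globalSections {ι : Type*} (s : Finset ι) (u : ι → Fin 3 → k) :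
    ∏ i ∈ s, H.affineForm (u i) ∈ H.globalSections s.card := by
  classical
  induction s using Finset.induction_on with
  | empty => exact one_mem_globalSections _
  | insert i s hi ih =>
    rw [Finset.prod_insert hi, Finset.card_insert_of_notMem hi]
    exact affineForm_mul_mem_globalSections _ ih

lemma CPoint.HasValue.prod_affineForm {V : H.CPoint} {a b : k} (hx : V.HasValue H.x a)
    (hy : V.HasValue H.y b) {ι : Type*} (s : Finset ι) (u : ι → Fin 3 → k) :
    V.HasValue (∏ i ∈ s, H.affineForm (u i)) (∏ i ∈ s, (u i 0 * a + u i 1 * b + u i 2)) := by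
  classical
  induction s using Finset.induction_on with
  | empty => simpa using V.hasValue_const 1
  | insert i s hi ih =>
    rw [Finset.prod_insert hi, Finset.prod_insert hi]
    exact (hx.affineForm hy _).mul ih

/-! ### The action of the `m`-th roots of unity -/

/-- The cofactor of `m` in `q + 1` works, because `q = 0` in `k`. -/
lemma exists_m_mul_eq_one : ∃ n : k, (H.m : k) * n = 1 := by
  obtain ⟨n, hn⟩ := H.dvd
  refine ⟨n, ?_⟩
  rw [← Nat.cast_mul, ← hn, Nat.cast_add, H.q_cast, zero_add, Nat.cast_one]

lemma m_cast_ne_zero : (H.m : k) ≠ 0 := by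
  obtain ⟨n, hn⟩ := exists_m_mul_eq_one (H := H)
  exact left_ne_zero_of_mul_eq_one hn

variable (H) in
lemma exists_generator : ∃ g : k, IsPrimitiveRoot g (H.q ^ 2 - 1) := by
  obtain ⟨g, hg⟩ := IsCyclic.exists_ofOrder_eq_natCard (α := kˣ)
  refine ⟨g, ?_⟩
  rw [IsPrimitiveRoot.coe_units_iff]
  rw [Nat.card_units, Nat.card_eq_fintype_card, H.card_eq] at hg
  exact hg ▸ IsPrimitiveRoot.orderOf g

lemma sq_sub_one_eq : ∃ n : ℕ, H.q ^ 2 - 1 = H.m * (n * (H.q - 1)) ∧ H.q + 1 = H.m * n := by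
  obtain ⟨n, hn⟩ := H.dvd
  refine ⟨n, ?_, hn⟩
  rw [← mul_assoc, ← hn, ← Nat.sq_sub_sq, one_pow]

variable (H) in
lemma exists_primitiveRoot : ∃ ζ : k, IsPrimitiveRoot ζ H.m := by
  obtain ⟨g, hg⟩ := H.exists_generator
  obtain ⟨n, hn, -⟩ := H.sq_sub_one_eq
  have := H.two_le_q
  refine ⟨g ^ (n * (H.q - 1)), hg.pow ?_ (by rw [hn, mul_comm])⟩
  exact Nat.sub_pos_of_lt (Nat.one_lt_pow (by norm_num) (by omega))

/-- Scaling the coordinate `x` by an `m`-th root of unity, on the affine part of `Y`. -/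
noncomputable def scaleCoord (H : HermitianQuotient k) (ζ : k) (hζ : ζ ^ H.m = 1) :
    H.CoordRing →+* H.CoordRing :=
  AdjoinRoot.lift (AdjoinRoot.of H.affinePoly) (algebraMap k H.CoordRing ζ * H.xA) (by
    have h : ∀ F : k[X][X], F = X ^ H.m - C (X ^ H.q + X) →
        eval₂ (AdjoinRoot.of H.affinePoly) (algebraMap k H.CoordRing ζ * H.xA) F =
          H.xA ^ H.m - (H.yA ^ H.q + H.yA) := by
      rintro F rfl
      rw [eval₂_sub, eval₂_pow, eval₂_X, eval₂_C, RingHom.map_add, RingHom.map_pow, mul_pow,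
        ← map_pow, hζ, map_one, one_mul]
      rfl
    rw [h H.affinePoly rfl, H.curve_eq, sub_self])

lemma scaleCoord_of (ζ : k) (hζ : ζ ^ H.m = 1) (p : k[X]) :
    H.scaleCoord ζ hζ (AdjoinRoot.of H.affinePoly p) = AdjoinRoot.of H.affinePoly p :=
  AdjoinRoot.lift_of _

lemma scaleCoord_xA (ζ : k) (hζ : ζ ^ H.m = 1) :
    H.scaleCoord ζ hζ H.xA = algebraMap k H.CoordRing ζ * H.xA :=
  AdjoinRoot.lift_root _

lemma scaleCoord_injective (ζ : k) (hζ : ζ ^ H.m = 1) :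
    Function.Injective (H.scaleCoord ζ hζ) := by
  have hζ0 : ζ ≠ 0 := by
    rintro rfl
    rw [zero_pow H.m_pos.ne'] at hζ
    exact zero_ne_one hζ
  have hζ' : ζ⁻¹ ^ H.m = 1 := by rw [inv_pow, hζ, inv_one]
  have key : (H.scaleCoord ζ⁻¹ hζ').comp (H.scaleCoord ζ hζ) = RingHom.id _ := by
    apply AdjoinRoot.ringHom_ext
    · ext p
      · simp only [RingHom.comp_apply, scaleCoord_of, RingHom.id_apply]
      · simp only [RingHom.comp_apply, scaleCoord_of, RingHom.id_apply]
    · change H.scaleCoord ζ⁻¹ hζ' (H.scaleCoord ζ hζ H.xA) = H.xA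
      rw [scaleCoord_xA, map_mul, scaleCoord_xA]
      have : H.scaleCoord ζ⁻¹ hζ' (algebraMap k H.CoordRing ζ) = algebraMap k H.CoordRing ζ :=
        scaleCoord_of _ _ _
      rw [this, ← mul_assoc, ← map_mul, mul_inv_cancel₀ hζ0, map_one, one_mul]
  exact Function.LeftInverse.injective (g := H.scaleCoord ζ⁻¹ hζ')
    fun a => congrArg (fun φ => φ a) key

/-- Scaling the coordinate `x` by an `m`-th root of unity, on the function field. -/
noncomputable def scale (H : HermitianQuotient k) (ζ : k) (hζ : ζ ^ H.m = 1) :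
    H.FunField →+* H.FunField :=
  IsFractionRing.map (scaleCoord_injective ζ hζ)

lemma scale_algebraMap (ζ : k) (hζ : ζ ^ H.m = 1) (p : k[X]) :
    H.scale ζ hζ (algebraMap k[X] H.FunField p) = algebraMap k[X] H.FunField p := by
  rw [IsScalarTower.algebraMap_apply k[X] H.CoordRing H.FunField, scale, IsFractionRing.map,
    IsLocalization.map_eq]
  exact congrArg _ (scaleCoord_of ζ hζ p)

lemma scale_y (ζ : k) (hζ : ζ ^ H.m = 1) : H.scale ζ hζ H.y = H.y := scale_algebraMap ζ hζ X

lemma scale_const (ζ : k) (hζ : ζ ^ H.m = 1) (c : k) :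
    H.scale ζ hζ (algebraMap k H.FunField c) = algebraMap k H.FunField c :=
  scale_algebraMap ζ hζ (C c)

lemma scale_x (ζ : k) (hζ : ζ ^ H.m = 1) :
    H.scale ζ hζ H.x = algebraMap k H.FunField ζ * H.x := by
  rw [x, scale, IsFractionRing.map, IsLocalization.map_eq, scaleCoord_xA, map_mul]
  rfl

/-- Scaling carries the stalk at the pulled-back point into the stalk at `V`, since it multiplies
the generators `x^i y^j` by constants. -/
lemma scale_mem_globalSections (ζ : k) (hζ : ζ ^ H.m = 1) {d : ℕ} {f : H.FunField}
    (hf : f ∈ H.globalSections d) : H.scale ζ hζ f ∈ H.globalSections d := by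
  intro V
  by_cases htop : V.1.comap (H.scale ζ hζ) = ⊤
  -- This case spares a proof that scaling is surjective: `scale f` is then regular at `V`, and `1`
  -- is among the generators of the stalk.
  · have hmem : H.scale ζ hζ f ∈ V.1 := by
      rw [← ValuationSubring.mem_comap, htop]; trivial
    simpa using V.mul_mem_stalk hmem (one_mem_globalSections d V)
  · let W : H.CPoint := ⟨V.1.comap (H.scale ζ hζ), fun c => by
      rw [ValuationSubring.mem_comap, scale_const]; exact V.2.1 c, htop⟩
    refine W.stalk_induction (motive := fun f => H.scale ζ hζ f ∈ V.stalk d) ?_ ?_ ?_ ?_ (hf W)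
    · intro i j h
      rw [map_mul, map_pow, map_pow, scale_x, scale_y, mul_pow, ← map_pow, mul_assoc]
      exact V.mul_mem_stalk (V.2.1 (ζ ^ i)) (Submodule.subset_span ⟨i, j, h, rfl⟩)
    · rw [map_zero]; exact zero_mem _
    · intro f g hf hg; rw [map_add]; exact add_mem hf hg
    · intro c hc f hf; rw [map_mul]; exact V.mul_mem_stalk hc hf

/-! ### Expansion of functions in powers of `x` -/

/-- The coordinate ring is finite over `k[y]`, so every denominator divides a nonzero polynomial in
`y`; the new numerator is then reduced modulo the equation, which is monic of degree `m` in `x`. -/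
lemma exists_expansion (f : H.FunField) : ∃ (p : k[X]) (g : ℕ → k[X]), p ≠ 0 ∧
    f = ∑ i ∈ Finset.range H.m, algebraMap k[X] H.FunField (g i) * H.x ^ i /
      algebraMap k[X] H.FunField p := by
  have hmonic : H.affinePoly.Monic := monic_X_pow_sub_C _ H.m_pos.ne'
  have : Module.Finite k[X] H.CoordRing := hmonic.finite_adjoinRoot
  obtain ⟨u, v, hv, rfl⟩ := IsFractionRing.div_surjective (A := H.CoordRing) f
  obtain ⟨p, hp, w, hw⟩ := (Algebra.IsAlgebraic.isAlgebraic (R := k[X]) v).exists_nonzero_dvd hv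
  obtain ⟨F, hF⟩ := AdjoinRoot.mk_surjective (u * w)
  refine ⟨p, (F %ₘ H.affinePoly).coeff, hp, ?_⟩
  have hv0 : algebraMap H.CoordRing H.FunField v ≠ 0 :=
    IsFractionRing.to_map_ne_zero_of_mem_nonZeroDivisors hv
  have hp0 : algebraMap k[X] H.FunField p ≠ 0 :=
    (map_ne_zero_iff _ algebraMap_polynomial_injective).mpr hp
  have hpvw : algebraMap k[X] H.FunField p =
      algebraMap H.CoordRing H.FunField v * algebraMap H.CoordRing H.FunField w := by
    rw [← map_mul, ← hw, ← IsScalarTower.algebraMap_apply]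
  have hdeg : (F %ₘ H.affinePoly).natDegree < H.m := by
    have := natDegree_modByMonic_lt F hmonic (by
      intro h
      have h' := congrArg natDegree h
      rw [affinePoly, natDegree_X_pow_sub_C, natDegree_one] at h'
      exact H.m_pos.ne' h')
    rwa [show H.affinePoly.natDegree = H.m from natDegree_X_pow_sub_C] at this
  have hsum : u * w = ∑ i ∈ Finset.range H.m,
      algebraMap k[X] H.CoordRing ((F %ₘ H.affinePoly).coeff i) * H.xA ^ i := by
    rw [← hF, ← AdjoinRoot.mk_leftInverse hmonic (AdjoinRoot.mk _ F), AdjoinRoot.modByMonicHom_mk]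
    conv_lhs => rw [as_sum_range' _ _ hdeg]
    rw [map_sum]
    refine Finset.sum_congr rfl fun i _ => ?_
    rw [← C_mul_X_pow_eq_monomial, map_mul, map_pow]
    rfl
  rw [← Finset.sum_div, div_eq_div_iff hv0 hp0, hpvw]
  have := congrArg (algebraMap H.CoordRing H.FunField) hsum
  rw [map_mul, map_sum] at this
  simp only [map_mul, map_pow, ← IsScalarTower.algebraMap_apply] at this
  rw [show algebraMap H.CoordRing H.FunField H.xA = H.x from rfl] at this
  rw [← this]; ring

/-- The isotypic components of a section are sections. -/
lemma component_mem_globalSections {d : ℕ} {p : k[X]} {g : ℕ → k[X]}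
    (hf : ∑ i ∈ Finset.range H.m, algebraMap k[X] H.FunField (g i) * H.x ^ i /
      algebraMap k[X] H.FunField p ∈ H.globalSections d) {i : ℕ} (hi : i < H.m) :
    algebraMap k[X] H.FunField (g i) * H.x ^ i / algebraMap k[X] H.FunField p ∈
      H.globalSections d := by
  obtain ⟨ζ, hζ⟩ := H.exists_primitiveRoot
  have hζ0 : ζ ≠ 0 := hζ.ne_zero H.m_pos.ne'
  have hpow : ∀ j : ℕ, (ζ ^ j) ^ H.m = 1 := fun j => by
    rw [← pow_mul, mul_comm, pow_mul, hζ.pow_eq_one, one_pow]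
  set s : ℕ → H.FunField := fun i => algebraMap k[X] H.FunField (g i) * H.x ^ i /
      algebraMap k[X] H.FunField p with hs
  have hscale : ∀ j l, H.scale (ζ ^ j) (hpow j) (s l) = (ζ ^ j) ^ l • s l := by
    intro j l
    simp only [hs]
    rw [map_div₀, map_mul, map_pow, scale_algebraMap, scale_algebraMap, scale_x, Algebra.smul_def,
      mul_pow]
    simp only [map_pow]
    ring
  -- Orthogonality of the characters of the group of `m`-th roots of unity.
  have horth : ∀ l < H.m, ∑ j ∈ Finset.range H.m, (ζ ^ j)⁻¹ ^ i * (ζ ^ j) ^ l =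
      if l = i then (H.m : k) else 0 := by
    intro l hl
    have e : ∀ j, (ζ ^ j)⁻¹ ^ i * (ζ ^ j) ^ l = ((ζ ^ i)⁻¹ * ζ ^ l) ^ j := by
      intro j
      rw [mul_pow, inv_pow, inv_pow, ← pow_mul, ← pow_mul, ← pow_mul, ← pow_mul, mul_comm i,
        mul_comm l]
    simp only [e]
    split_ifs with h
    · subst h
      rw [inv_mul_cancel₀ (pow_ne_zero _ hζ0)]
      simp
    · have h1 : (ζ ^ i)⁻¹ * ζ ^ l - 1 ≠ 0 := by
        intro h0
        refine h (hζ.pow_inj hl hi ?_)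
        rw [sub_eq_zero] at h0
        exact (inv_mul_eq_one₀ (pow_ne_zero _ hζ0)).mp h0 |>.symm
      refine (mul_eq_zero_iff_left h1).mp ?_
      rw [mul_geom_sum, mul_pow, inv_pow, hpow, hpow]
      simp
  -- The twisted sum over the group projects onto the component of index `i`, up to the factor `m`,
  -- which is invertible in `k`.
  have key : ∑ j ∈ Finset.range H.m, (ζ ^ j)⁻¹ ^ i •
      H.scale (ζ ^ j) (hpow j) (∑ l ∈ Finset.range H.m, s l) = (H.m : k) • s i := by
    simp only [map_sum, hscale, Finset.smul_sum, smul_smul]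
    rw [Finset.sum_comm]
    simp only [← Finset.sum_smul]
    rw [Finset.sum_congr rfl fun l hl => by rw [horth l (Finset.mem_range.mp hl)]]
    simp [Finset.sum_ite_eq', hi]
  have hmem : (H.m : k) • s i ∈ H.globalSections d := by
    rw [← key]
    exact sum_mem fun j _ => Submodule.smul_mem _ _ (scale_mem_globalSections _ _ hf)
  have := Submodule.smul_mem _ (H.m : k)⁻¹ hmem
  rwa [smul_smul, inv_mul_cancel₀ m_cast_ne_zero, one_smul] at this

/-! ### Global sections are polynomials -/

variable (H) in
/-- The polynomial `y^q + y`. -/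
noncomputable def rhsPoly : k[X] := X ^ H.q + X

lemma algebraMap_rhsPoly : algebraMap k[X] H.FunField H.rhsPoly = H.x ^ H.m := by
  rw [rhsPoly, map_add, map_pow, algebraMap_X, curve_eq_funField]

lemma rhsPoly_natDegree : H.rhsPoly.natDegree = H.q := by
  have := H.two_le_q
  rw [rhsPoly, natDegree_add_eq_left_of_natDegree_lt, natDegree_X_pow]
  rw [natDegree_X_pow, natDegree_X]
  omega

lemma rhsPoly_ne_zero : H.rhsPoly ≠ 0 := by
  intro h
  have h1 := rhsPoly_natDegree (H := H)
  have := H.two_le_q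
  rw [h, natDegree_zero] at h1
  omega

/-- The derivative of `y^q + y` is `1`, because `q = 0` in `k`. -/
lemma rhsPoly_squarefree : Squarefree H.rhsPoly := by
  apply Separable.squarefree
  rw [separable_def]
  have : derivative H.rhsPoly = 1 := by
    rw [rhsPoly, derivative_add, derivative_X_pow, derivative_X, H.q_cast, C_0, zero_mul, zero_add]
  rw [this]
  exact isCoprime_one_right

lemma isIntegral_y : IsIntegral k[X] H.y := by
  rw [← algebraMap_X]; exact isIntegral_algebraMap

lemma isIntegral_x : IsIntegral k[X] H.x := by
  refine IsIntegral.of_pow H.m_pos ?_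
  rw [← algebraMap_rhsPoly]; exact isIntegral_algebraMap

lemma CPoint.stalk_le_of_mem (V : H.CPoint) (hx : H.x ∈ V.1) (hy : H.y ∈ V.1) {d : ℕ}
    {f : H.FunField} (hf : f ∈ V.stalk d) : f ∈ V.1 :=
  V.stalk_induction (motive := (· ∈ V.1))
    (fun i j _ => V.1.mul_mem _ _ (pow_mem hx i) (pow_mem hy j)) V.1.zero_mem
    (fun _ _ => V.1.add_mem _ _) (fun _ hc _ => V.1.mul_mem _ _ hc) hf

/-- Otherwise some valuation ring contains the integral closure of `k[y]` but not `f`. It is a point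
of `C` where `x` and `y` are regular, and there the stalk lies in the local ring. -/
lemma isIntegral_of_mem_globalSections {d : ℕ} {f : H.FunField} (hf : f ∈ H.globalSections d) :
    IsIntegral k[X] f := by
  by_contra h
  obtain ⟨V, hV, hfV⟩ := Subring.exists_le_valuationSubring_of_isIntegrallyClosedIn
    (x := f) (R := (integralClosure k[X] H.FunField).toSubring) h
  have hc : ∀ c : k, algebraMap k H.FunField c ∈ V := fun c => by
    rw [← algebraMap_C]
    exact hV (isIntegral_algebraMap (R := k[X]) (A := H.FunField) (x := C c))
  have htop : V ≠ ⊤ := by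
    rintro rfl
    exact hfV trivial
  exact hfV (CPoint.stalk_le_of_mem ⟨V, hc, htop⟩ (hV isIntegral_x) (hV isIntegral_y)
    (hf ⟨V, hc, htop⟩))

/-- An integral fraction of polynomials in `y` is a polynomial in `y`. -/
lemma dvd_of_isIntegral_div {u p : k[X]} (hp : p ≠ 0)
    (h : IsIntegral k[X] (algebraMap k[X] H.FunField u / algebraMap k[X] H.FunField p)) :
    p ∣ u := by
  -- Integrality is tested in the subfield `k(y)`, where `k[y]` is integrally closed.
  let φ : FractionRing k[X] →ₐ[k[X]] H.FunField :=
    IsFractionRing.liftAlgHom (g := Algebra.ofId k[X] H.FunField) algebraMap_polynomial_injective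
  have hφ : φ (algebraMap _ _ u / algebraMap _ _ p) =
      algebraMap k[X] H.FunField u / algebraMap k[X] H.FunField p := by
    rw [map_div₀, AlgHom.commutes, AlgHom.commutes]
  rw [← hφ, isIntegral_algHom_iff φ φ.toRingHom.injective, IsIntegrallyClosed.isIntegral_iff] at h
  obtain ⟨r, hr⟩ := h
  have hp0 : algebraMap k[X] (FractionRing k[X]) p ≠ 0 := by simpa using hp
  rw [eq_div_iff hp0, ← map_mul] at hr
  exact ⟨r, by rw [mul_comm, IsFractionRing.injective k[X] (FractionRing k[X]) hr]⟩

lemma algebraMap_eq_aeval (p : k[X]) : algebraMap k[X] H.FunField p = aeval H.y p := by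
  rw [← algebraMap_X, aeval_algebraMap_apply, aeval_X_left_apply]

/-- Being transcendental, `y` is not integral over `k`, so some valuation ring containing the
constants omits it. -/
lemma exists_cPoint_infinity : ∃ V : H.CPoint, H.y ∉ V.1 := by
  have hy : ¬ IsIntegral k H.y := by
    rintro ⟨p, hp, h⟩
    have h' : algebraMap k[X] H.FunField p = 0 := by
      rw [algebraMap_eq_aeval]; exact h
    exact hp.ne_zero ((map_eq_zero_iff _ algebraMap_polynomial_injective).mp h')
  obtain ⟨V, hV, hyV⟩ := Subring.exists_le_valuationSubring_of_isIntegrallyClosedIn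
    (x := H.y) (R := (integralClosure k H.FunField).toSubring) hy
  refine ⟨⟨V, fun c => hV (isIntegral_algebraMap (R := k) (A := H.FunField) (x := c)), ?_⟩, hyV⟩
  rintro rfl
  exact hyV trivial

lemma CPoint.valuation_polynomial (V : H.CPoint) (hy : H.y ∉ V.1) {p : k[X]} (hp : p ≠ 0) :
    V.1.valuation (algebraMap k[X] H.FunField p) = V.1.valuation H.y ^ p.natDegree := by
  have hy1 : 1 < V.1.valuation H.y := by
    rwa [← not_le, V.1.valuation_le_one_iff]
  have : V.1.valuation.IsTrivialOn k := ⟨fun c hc => V.valuation_const hc⟩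
  rw [algebraMap_eq_aeval]
  exact valuation_aeval_eq_valuation_X_pow_natDegree_of_one_lt_valuation_X _ hy1 hp

/-- At a pole of `y`, the valuations of `x^m` and `y^q` agree; as `m < q`, the pole of `x` is at
least as bad, so `x^d` dominates all generators of the stalk. -/
lemma CPoint.valuation_le_of_mem_stalk (V : H.CPoint) (hy : H.y ∉ V.1) {d : ℕ} {f : H.FunField}
    (hf : f ∈ V.stalk d) : V.1.valuation f ≤ V.1.valuation H.x ^ d := by
  have hy1 : 1 < V.1.valuation H.y := by
    rwa [← not_le, V.1.valuation_le_one_iff]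
  have hxy : V.1.valuation H.x ^ H.m = V.1.valuation H.y ^ H.q := by
    rw [← map_pow, ← algebraMap_rhsPoly, V.valuation_polynomial hy rhsPoly_ne_zero,
      rhsPoly_natDegree]
  have hle : V.1.valuation H.y ≤ V.1.valuation H.x := by
    refine le_of_pow_le_pow_left₀ H.m_pos.ne' zero_le ?_
    rw [hxy]
    exact pow_le_pow_right₀ hy1.le H.m_lt.le
  have hx1 := hy1.le.trans hle
  refine V.stalk_induction (motive := fun f => V.1.valuation f ≤ V.1.valuation H.x ^ d)
    ?_ ?_ ?_ ?_ hf
  · intro i j hij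
    rw [map_mul, map_pow, map_pow]
    calc _ ≤ V.1.valuation H.x ^ i * V.1.valuation H.x ^ j := by gcongr
      _ = V.1.valuation H.x ^ (i + j) := (pow_add _ _ _).symm
      _ ≤ _ := pow_le_pow_right₀ hx1 hij
  · rw [map_zero]; exact zero_le
  · intro f g hf hg; exact Valuation.map_add_le _ hf hg
  · intro c hc f hf
    rw [map_mul]
    exact mul_le_of_le_one_of_le ((V.1.valuation_le_one_iff _).mpr hc) hf

/-- A section of the form `g(y) x^i / p(y)` has no denominator, and `i ≤ d` if it is not zero. -/
lemma component_polynomial {d i : ℕ} (hi : i < H.m) {g p : k[X]} (hp : p ≠ 0)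
    (hs : algebraMap k[X] H.FunField g * H.x ^ i / algebraMap k[X] H.FunField p ∈
      H.globalSections d) :
    ∃ r : k[X], algebraMap k[X] H.FunField g * H.x ^ i / algebraMap k[X] H.FunField p =
      algebraMap k[X] H.FunField r * H.x ^ i ∧ (d < i → r = 0) := by
  set c := H.rhsPoly with hc
  have hp0 : algebraMap k[X] H.FunField p ≠ 0 :=
    (map_ne_zero_iff _ algebraMap_polynomial_injective).mpr hp
  have hint := isIntegral_of_mem_globalSections hs
  have hx : ∀ n, (H.x ^ n) ^ H.m = algebraMap k[X] H.FunField (c ^ n) := fun n => by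
    rw [map_pow, algebraMap_rhsPoly, ← pow_mul, ← pow_mul, mul_comm]
  -- The `m`-th power of the section lies in `k(y)`, as `x^m = c(y)`.
  obtain ⟨h, hh⟩ : p ^ H.m ∣ g ^ H.m * c ^ i := by
    refine dvd_of_isIntegral_div (H := H) (pow_ne_zero _ hp) ?_
    have := hint.pow H.m
    rwa [div_pow, mul_pow, hx, ← map_pow, ← map_pow, ← map_mul] at this
  -- The fraction `g c / p` is integral: its `m`-th power is the polynomial `h c^(m-i)`.
  obtain ⟨G, hG⟩ : p ∣ g * c := by
    refine dvd_of_isIntegral_div (H := H) hp (IsIntegral.of_pow H.m_pos ?_)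
    have : (algebraMap k[X] H.FunField (g * c) / algebraMap k[X] H.FunField p) ^ H.m =
        algebraMap k[X] H.FunField (h * c ^ (H.m - i)) := by
      rw [div_pow, div_eq_iff (pow_ne_zero _ hp0), ← map_pow, ← map_pow, ← map_mul]
      congr 1
      have e : c ^ H.m = c ^ i * c ^ (H.m - i) := by rw [← pow_add]; congr 1; omega
      rw [mul_pow, e]
      linear_combination c ^ (H.m - i) * hh
    rw [this]
    exact isIntegral_algebraMap
  -- Since `G^m = h c^(m-i)` with `m - i ≥ 1` and `c` is squarefree, `c` divides `G`; cancelling it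
  -- gives `p ∣ g`.
  have hcG : c ∣ G := by
    refine (rhsPoly_squarefree.dvd_pow_iff_dvd H.m_pos.ne').mp ?_
    have e : G ^ H.m = h * c ^ (H.m - i) := by
      apply mul_left_cancel₀ (pow_ne_zero H.m hp)
      have e : c ^ H.m = c ^ i * c ^ (H.m - i) := by rw [← pow_add]; congr 1; omega
      rw [← mul_pow, ← hG, mul_pow, e]
      linear_combination c ^ (H.m - i) * hh
    rw [e]
    exact (dvd_pow_self c (by omega)).mul_left h
  obtain ⟨r, rfl⟩ := hcG
  have hg : g = p * r := mul_right_cancel₀ (rhsPoly_ne_zero (H := H))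
    (by rw [← hc, hG]; ring)
  have hsr : algebraMap k[X] H.FunField g * H.x ^ i / algebraMap k[X] H.FunField p =
      algebraMap k[X] H.FunField r * H.x ^ i := by
    rw [hg, map_mul, div_eq_iff hp0]; ring
  refine ⟨r, hsr, fun hdi => ?_⟩
  by_contra hr
  obtain ⟨V, hV⟩ := exists_cPoint_infinity (H := H)
  rw [hsr] at hs
  have h1 := pow_le_pow_left₀ zero_le (V.valuation_le_of_mem_stalk hV (hs V)) H.m
  -- After taking `m`-th powers, the pole orders at `V` compare as `m * deg r + i * q ≤ d * q`,
  -- impossible for `d < i`.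
  rw [← map_pow, mul_pow, hx, ← map_pow, ← map_pow, ← map_mul, ← map_pow, hx,
    V.valuation_polynomial hV (mul_ne_zero (pow_ne_zero _ hr) (pow_ne_zero _ rhsPoly_ne_zero)),
    V.valuation_polynomial hV (pow_ne_zero _ rhsPoly_ne_zero)] at h1
  have hy1 : 1 < V.1.valuation H.y := by
    rwa [← not_le, V.1.valuation_le_one_iff]
  rw [pow_le_pow_iff_right₀ hy1, natDegree_mul (pow_ne_zero _ hr) (pow_ne_zero _ rhsPoly_ne_zero),
    natDegree_pow, natDegree_pow, natDegree_pow, rhsPoly_natDegree] at h1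
  have := H.two_le_q
  nlinarith [Nat.zero_le (H.m * r.natDegree)]

/-- Only the degree in `x` has to be controlled: on a line `y = b` the coefficients become
constants. -/
theorem exists_polynomial_of_mem_globalSections {d : ℕ} (hd : d < H.m) {f : H.FunField}
    (hf : f ∈ H.globalSections d) : ∃ r : ℕ → k[X],
      f = ∑ i ∈ Finset.range (d + 1), algebraMap k[X] H.FunField (r i) * H.x ^ i := by
  obtain ⟨p, g, hp, rfl⟩ := exists_expansion f
  choose! r hr hr0 using fun i (hi : i < H.m) =>
    component_polynomial hi hp (component_mem_globalSections hf hi)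
  refine ⟨r, ?_⟩
  rw [Finset.sum_congr rfl fun i hi => hr i (Finset.mem_range.mp hi)]
  symm
  refine Finset.sum_subset (Finset.range_subset_range.mpr hd) fun i hi hi' => ?_
  rw [Finset.mem_range] at hi hi'
  rw [hr0 i hi (by omega), map_zero, zero_mul]

end HermitianQuotient

/-! ### Points in the affine plane and affine forms -/

section Separation

variable {k ι : Type*} [Field k] [Fintype ι] {a b w : ι → k} {d : ℕ}

lemma exists_line_separating {a₁ b₁ a₂ b₂ : k} (h : a₁ ≠ a₂ ∨ b₁ ≠ b₂) :
    ∃ u : Fin 3 → k, u 0 * a₁ + u 1 * b₁ + u 2 = 0 ∧ u 0 * a₂ + u 1 * b₂ + u 2 ≠ 0 := by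
  rcases h with h | h
  · refine ⟨![1, 0, -a₁], by simp, ?_⟩
    simpa [← sub_eq_add_neg, sub_eq_zero] using h.symm
  · refine ⟨![0, 1, -b₁], by simp, ?_⟩
    simpa [← sub_eq_add_neg, sub_eq_zero] using h.symm

lemma exists_line_through {a₁ b₁ a₂ b₂ : k} (h : a₁ ≠ a₂ ∨ b₁ ≠ b₂) :
    ∃ u : Fin 3 → k, u ≠ 0 ∧ u 0 * a₁ + u 1 * b₁ + u 2 = 0 ∧
      u 0 * a₂ + u 1 * b₂ + u 2 = 0 := by
  -- Up to sign, the cross product of `(a₁, b₁, 1)` and `(a₂, b₂, 1)`.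
  refine ⟨![b₂ - b₁, a₁ - a₂, a₂ * b₁ - a₁ * b₂], fun h0 => ?_, ?_, ?_⟩
  · have h1 : b₂ - b₁ = 0 := congrFun h0 0
    have h2 : a₁ - a₂ = 0 := congrFun h0 1
    rcases h with h | h
    · exact h (sub_eq_zero.mp h2)
    · exact h (sub_eq_zero.mp h1).symm
  · simp; ring
  · simp; ring

/-- The product of the lines vanishes at every support point except `o`, so the orthogonality
relation reduces to one nonzero term. -/
lemma false_of_separating
    (hw : ∀ (s : Finset ι) (u : ι → Fin 3 → k), s.card ≤ d →
      ∑ j, w j * ∏ i ∈ s, (u i 0 * a j + u i 1 * b j + u i 2) = 0)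
    {s : Finset ι} (hs : s.card ≤ d) (u : ι → Fin 3 → k) {o : ι} (ho : w o ≠ 0)
    (hne : ∀ i ∈ s, u i 0 * a o + u i 1 * b o + u i 2 ≠ 0)
    (heq : ∀ j, j ≠ o → w j ≠ 0 → ∃ i ∈ s, u i 0 * a j + u i 1 * b j + u i 2 = 0) : False := by
  have h := hw s u hs
  rw [Finset.sum_eq_single o] at h
  · exact mul_ne_zero ho (Finset.prod_ne_zero_iff.mpr hne) h
  · intro j _ hj
    by_cases hwj : w j = 0
    · rw [hwj, zero_mul]
    · obtain ⟨i, hi, h0⟩ := heq j hj hwj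
      rw [Finset.prod_eq_zero hi h0, mul_zero]
  · simp

variable [DecidableEq k]

/-- At most `d + 1` points impose independent conditions on products of `d` affine forms. -/
lemma add_two_le_hammingNorm (hab : ∀ i j, i ≠ j → a i ≠ a j ∨ b i ≠ b j)
    (hw : ∀ (s : Finset ι) (u : ι → Fin 3 → k), s.card ≤ d →
      ∑ j, w j * ∏ i ∈ s, (u i 0 * a j + u i 1 * b j + u i 2) = 0) (hw0 : w ≠ 0) :
    d + 2 ≤ hammingNorm w := by
  classical
  by_contra hlt
  obtain ⟨o, ho⟩ : ∃ o, w o ≠ 0 := Function.ne_iff.mp hw0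
  choose! u hu hu' using fun i (hi : i ≠ o) => exists_line_separating (hab i o hi)
  -- One line for each support point other than `o`: at most `d` lines.
  refine false_of_separating hw (s := (Finset.univ.filter (w · ≠ 0)).erase o) ?_ u ho
    (fun i hi => hu' i (Finset.ne_of_mem_erase hi))
    (fun j hj hwj => ⟨j, by simp [hj, hwj], hu j hj⟩)
  rw [Finset.card_erase_of_mem (by simpa using ho)]
  unfold hammingNorm at hlt
  omega

/-- If `d + 2` points do not impose independent conditions on products of `d` affine forms, they
are collinear. -/
lemma exists_line_of_hammingNorm_eq (hab : ∀ i j, i ≠ j → a i ≠ a j ∨ b i ≠ b j)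
    (hw : ∀ (s : Finset ι) (u : ι → Fin 3 → k), s.card ≤ d →
      ∑ j, w j * ∏ i ∈ s, (u i 0 * a j + u i 1 * b j + u i 2) = 0)
    (hcard : hammingNorm w = d + 2) :
    ∃ u : Fin 3 → k, u ≠ 0 ∧ ∀ j, w j ≠ 0 → u 0 * a j + u 1 * b j + u 2 = 0 := by
  classical
  set S := Finset.univ.filter (w · ≠ 0) with hS
  have hScard : S.card = d + 2 := hcard
  obtain ⟨o₁, h₁, o₂, h₂, h12⟩ := Finset.one_lt_card.mp (by omega : 1 < S.card)
  obtain ⟨l, hl0, hl₁, hl₂⟩ := exists_line_through (hab o₁ o₂ h12)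
  refine ⟨l, hl0, fun o ho => ?_⟩
  by_contra hlo
  have ho₁ : o ≠ o₁ := by rintro rfl; exact hlo hl₁
  have ho₂ : o ≠ o₂ := by rintro rfl; exact hlo hl₂
  choose! u hu hu' using fun i (hi : i ≠ o) => exists_line_separating (hab i o hi)
  -- The line `l`, placed at index `o₁`, also takes care of `o₂`, so `d` lines suffice for the `d +
  -- 1` points other than `o`.
  refine false_of_separating hw (s := (S.erase o).erase o₂) ?_ (Function.update u o₁ l) ho ?_ ?_
  · rw [Finset.card_erase_of_mem (by simp [h₂, ho₂.symm]),
      Finset.card_erase_of_mem (by simpa [hS] using ho)]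
    omega
  · intro i hi
    by_cases hi₁ : i = o₁
    · subst hi₁; simpa using hlo
    · rw [Function.update_of_ne hi₁]
      exact hu' i (Finset.ne_of_mem_erase (Finset.mem_of_mem_erase hi))
  · intro j hj hwj
    by_cases hj₂ : j = o₂
    · subst hj₂
      exact ⟨o₁, by simp [h₁, ho₁.symm, h12], by simpa using hl₂⟩
    · refine ⟨j, by simp [hj₂, hj, hS, hwj], ?_⟩
      by_cases hj₁ : j = o₁
      · subst hj₁; simpa using hl₁
      · rw [Function.update_of_ne hj₁]; exact hu j hj

end Separation

/-- The points of a line `u 0 * x + u 1 * y + u 2 * z = 0` of the projective plane are collinear. -/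
lemma isCollinear_of_forall_rep {k : Type*} [Field k] {u : Fin 3 → k} (hu : u ≠ 0)
    {S : Set (ℙ k (Fin 3 → k))} (hS : ∀ P ∈ S, u ⬝ᵥ P.rep = 0) :
    Projectivization.IsCollinear S := by
  let φ : (Fin 3 → k) →ₗ[k] k := dotProductBilin k k u
  have hφ : ∀ v, φ v = u ⬝ᵥ v := fun _ => rfl
  have hφ0 : φ ≠ 0 := by
    intro h
    apply hu
    ext i
    have := hφ (Pi.single i 1)
    rw [h, dotProduct_single_one] at this
    exact this.symm
  refine ⟨(LinearMap.ker φ).projectivization, ?_, ?_, ?_⟩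
  · rw [Projectivization.Subspace.submodule.apply_symm_apply]
    infer_instance
  · rw [Projectivization.Subspace.submodule.apply_symm_apply]
    have h1 := φ.finrank_range_add_finrank_ker
    rw [LinearMap.range_eq_top.mpr (LinearMap.surjective hφ0), finrank_top, Module.finrank_self,
      Module.finrank_fin_fun] at h1
    omega
  · intro P hP
    rw [SetLike.mem_coe, ← P.mk_rep, Submodule.mk_mem_projectivization_iff, LinearMap.mem_ker]
    exact hS P hP

namespace HermitianQuotient

variable {k : Type*} [Field k] [Fintype k] {H : HermitianQuotient k}

/-! ### The points on a horizontal line -/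

/-- Nonzero elements fixed by the `q`-th power map are powers of `g^(q+1)` for a generator `g` of
the unit group, and `m` divides `q + 1`. -/
lemma exists_eq_pow_m {c : k} (hc : c ≠ 0) (hcq : c ^ H.q = c) : ∃ a : k, a ^ H.m = c := by
  obtain ⟨g, hg⟩ := H.exists_generator
  obtain ⟨n, -, hn⟩ := H.sq_sub_one_eq
  have hq := H.two_le_q
  have hpos : 0 < H.q ^ 2 - 1 := Nat.sub_pos_of_lt (Nat.one_lt_pow (by norm_num) (by omega))
  have hc1 : c ^ (H.q ^ 2 - 1) = 1 := by
    rw [← H.card_eq]; exact FiniteField.pow_card_sub_one_eq_one c hc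
  have : NeZero (H.q ^ 2 - 1) := ⟨hpos.ne'⟩
  obtain ⟨t, -, rfl⟩ := hg.eq_pow_of_pow_eq_one hc1
  have h1 : g ^ (t * (H.q - 1)) = 1 := by
    apply mul_right_cancel₀ hc
    rw [one_mul, pow_mul, ← pow_succ, Nat.sub_add_cancel (by omega), hcq]
  have h2 := hg.dvd_of_pow_eq_one _ h1
  have e : H.q ^ 2 - 1 = (H.q + 1) * (H.q - 1) := by rw [← Nat.sq_sub_sq, one_pow]
  rw [e] at h2
  obtain ⟨l, rfl⟩ := Nat.dvd_of_mul_dvd_mul_right (by omega) h2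
  refine ⟨g ^ (n * l), ?_⟩
  rw [← pow_mul, hn]; congr 1; ring

lemma pow_q_add (a b : k) : (a + b) ^ H.q = a ^ H.q + b ^ H.q := by
  obtain ⟨p, _⟩ := CharP.exists k
  obtain ⟨n, hp, hn⟩ := FiniteField.card k p
  have : Fact p.Prime := ⟨hp⟩
  have hdvd : H.q ∣ p ^ (n : ℕ) := by
    rw [← hn, H.card_eq]; exact dvd_pow_self _ two_ne_zero
  obtain ⟨r, -, hr⟩ := (Nat.dvd_prime_pow hp).mp hdvd
  rw [hr, add_pow_char_pow]

/-- Some horizontal line contains `m` affine rational points of `Y`. -/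
lemma exists_line_points : ∃ (b : k) (a : Fin H.m → k), Function.Injective a ∧
    ∀ i, b ^ H.q + b = a i ^ H.m := by
  have hq := H.two_le_q
  obtain ⟨b, hb⟩ : ∃ b : k, H.rhsPoly.eval b ≠ 0 := by
    refine exists_eval_ne_zero_of_natDegree_lt_card _ rhsPoly_ne_zero ?_
    rw [rhsPoly_natDegree, Cardinal.mk_fintype, H.card_eq]
    exact_mod_cast (by nlinarith : H.q < H.q ^ 2)
  rw [rhsPoly, eval_add, eval_pow, eval_X] at hb
  -- The trace `b^q + b` is fixed by the `q`-th power map, because `b^(q^2) = b`.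
  obtain ⟨a, ha⟩ := exists_eq_pow_m (H := H) hb (by
    rw [pow_q_add, ← pow_mul, ← sq, ← H.card_eq, FiniteField.pow_card, add_comm])
  have ha0 : a ≠ 0 := by
    rintro rfl
    rw [zero_pow H.m_pos.ne'] at ha
    exact hb ha.symm
  obtain ⟨ζ, hζ⟩ := H.exists_primitiveRoot
  refine ⟨b, fun i => a * ζ ^ (i : ℕ), fun i j h => ?_, fun i => ?_⟩
  · exact Fin.ext (hζ.pow_inj i.2 j.2 (mul_left_cancel₀ ha0 h))
  · rw [mul_pow, ← pow_mul, mul_comm (i : ℕ), pow_mul, hζ.pow_eq_one, one_pow, mul_one, ha]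

/-! ### The dual of the complete code -/

lemma evalPoint_coords (V : H.evalPoints) :
    ∃ a b : k, b ^ H.q + b = a ^ H.m ∧ V.1.HasValue H.x a ∧ V.1.HasValue H.y b :=
  V.1.exists_coords V.2.choose_spec.1 V.2.choose_spec.2

/-- On `d + 2` points of a horizontal line, sections are polynomials in `x` of degree at most `d`:
these are `d + 1` linear conditions on `d + 2` unknowns. -/
lemma exists_dual_codeword [DecidableEq k] {d : ℕ} (hdm : d + 2 ≤ H.m) :
    ∃ w ∈ dualCode (H.completeCode d), w ≠ 0 ∧ hammingNorm w ≤ d + 2 := by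
  classical
  obtain ⟨b, a, ha, hab⟩ := exists_line_points (H := H)
  choose V hVx hVy using fun i => exists_evalPoint (a i) b (hab i)
  let P : Fin (d + 2) → H.evalPoints := fun i => V (Fin.castLE hdm i)
  let α : Fin (d + 2) → k := fun i => a (Fin.castLE hdm i)
  have hP : Function.Injective P := fun i j h => Fin.castLE_injective hdm (ha
    ((hVx _).unique (by rw [show V _ = V _ from h]; exact hVx _)))
  let L : (Fin (d + 2) → k) →ₗ[k] (Fin (d + 1) → k) :=
    Matrix.mulVecLin (Matrix.of fun i j => α j ^ (i : ℕ))
  obtain ⟨v, hv, hv0⟩ := L.ker.exists_mem_ne_zero_of_ne_bot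
    (LinearMap.ker_ne_bot_of_finrank_lt (by simp))
  have hLv : ∀ i : Fin (d + 1), ∑ j, α j ^ (i : ℕ) * v j = 0 := fun i => congrFun hv i
  let w : H.evalPoints → k := ∑ j, Pi.single (P j) (v j)
  have hwdot : ∀ c, w ⬝ᵥ c = ∑ j, v j * c (P j) := fun c => by
    simp only [w, sum_dotProduct, single_dotProduct]
  refine ⟨w, ?_, ?_, ?_⟩
  · rintro c ⟨f, hf, hc⟩
    obtain ⟨r, rfl⟩ := exists_polynomial_of_mem_globalSections (by omega) hf
    have hcP : ∀ j, c (P j) = ∑ i ∈ Finset.range (d + 1), (r i).eval b * α j ^ i := fun j =>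
      (hc (P j)).unique (CPoint.HasValue.sum _ fun i _ =>
        ((hVy _).polynomial (r i)).mul ((hVx _).pow i))
    rw [hwdot]
    simp only [hcP, Finset.mul_sum]
    rw [Finset.sum_comm]
    refine Finset.sum_eq_zero fun i hi => ?_
    have := hLv ⟨i, Finset.mem_range.mp hi⟩
    calc _ = (r i).eval b * ∑ j, α j ^ i * v j := by
          rw [Finset.mul_sum]; exact Finset.sum_congr rfl fun j _ => by ring
      _ = 0 := by rw [this, mul_zero]
  · intro h0
    apply hv0
    ext j
    -- Pairing with an indicator word recovers `v j`, since the chosen points are distinct.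
    have := hwdot (Pi.single (P j) 1)
    rw [h0, zero_dotProduct, Finset.sum_eq_single j] at this
    · simpa using this.symm
    · intro i _ hij
      rw [Pi.single_eq_of_ne (fun h => hij (hP h)), mul_zero]
    · simp
  · unfold hammingNorm
    refine (Finset.card_le_card (t := Finset.univ.image P) fun Q hQ => ?_).trans
      (Finset.card_image_le.trans (by simp))
    rw [Finset.mem_filter] at hQ
    by_contra hQP
    apply hQ.2
    simp only [w, Finset.sum_apply]
    refine Finset.sum_eq_zero fun j _ => Pi.single_eq_of_ne (fun h => hQP ?_) _
    exact h ▸ Finset.mem_image_of_mem P (Finset.mem_univ j)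

/-- Codewords of the dual code are orthogonal to products of at most `d` affine forms. -/
lemma dualCode_orthogonal {d : ℕ} {a b w : H.evalPoints → k}
    (hx : ∀ V : H.evalPoints, V.1.HasValue H.x (a V))
    (hy : ∀ V : H.evalPoints, V.1.HasValue H.y (b V)) (hw : w ∈ dualCode (H.completeCode d))
    {ι : Type*} (s : Finset ι) (u : ι → Fin 3 → k) (hs : s.card ≤ d) :
    ∑ V, w V * ∏ i ∈ s, (u i 0 * a V + u i 1 * b V + u i 2) = 0 :=
  hw (fun V => ∏ i ∈ s, (u i 0 * a V + u i 1 * b V + u i 2))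
    ⟨_, globalSections_mono hs (prod_affineForm_mem_globalSections s u),
      fun V => (hx V).prod_affineForm (hy V) s u⟩

end HermitianQuotient

/-! ### Minimum distance and minimum-weight codewords. -/

theorem mainTheorem5 {k : Type*} [Field k] [Fintype k] [DecidableEq k]
    (H : HermitianQuotient k) (d : ℕ) (hd : 0 < d) (hdm : d + 2 ≤ H.m) :
    HasMinDistance (dualCode (H.completeCode d)) (d + 2) ∧
    ∀ w : H.evalPoints → k, IsMinWeightCodeword (dualCode (H.completeCode d)) w →
      (Function.support w).ncard = d + 2 ∧
      Projectivization.IsCollinear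
        {P : HermitianQuotient.Plane k | ∃ V : H.evalPoints, w V ≠ 0 ∧ V.1.MapsTo P} := by
  choose a b hab hx hy using H.evalPoint_coords
  have hinj : ∀ V W : H.evalPoints, V ≠ W → a V ≠ a W ∨ b V ≠ b W := by
    intro V W hVW
    by_contra! h
    exact hVW (Subtype.ext (HermitianQuotient.CPoint.ext_of_coords (hab V) (hx V) (hy V)
      (h.1 ▸ hx W) (h.2 ▸ hy W)))
  have hlow : ∀ w ∈ dualCode (H.completeCode d), w ≠ 0 → d + 2 ≤ hammingNorm w := fun w hw =>
    add_two_le_hammingNorm hinj (HermitianQuotient.dualCode_orthogonal hx hy hw)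
  obtain ⟨w₀, hw₀, hne, hle⟩ := HermitianQuotient.exists_dual_codeword hdm
  refine ⟨⟨⟨w₀, hw₀, 0, zero_mem _, hne, ?_⟩, ?_⟩, ?_⟩
  · rw [hammingDist_zero_right]
    exact le_antisymm hle (hlow w₀ hw₀ hne)
  · rintro l ⟨v, hv, w, hw, hvw, rfl⟩
    rw [hammingDist_eq_hammingNorm]
    exact hlow _ (add_mem (neg_mem hv) hw) fun h => hvw (neg_add_eq_zero.mp h)
  · rintro w ⟨hw, hw0, hmin⟩
    have hcard : hammingNorm w = d + 2 :=
      le_antisymm ((hmin w₀ hw₀ hne).trans hle) (hlow w hw hw0)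
    refine ⟨?_, ?_⟩
    · rw [← hcard, hammingNorm, ← Set.ncard_coe_finset]
      congr 1
      ext V
      simp
    · obtain ⟨u, hu, hline⟩ :=
        exists_line_of_hammingNorm_eq hinj (HermitianQuotient.dualCode_orthogonal hx hy hw) hcard
      refine isCollinear_of_forall_rep hu ?_
      rintro P ⟨V, hV, hVP⟩
      obtain ⟨h0, h1⟩ := hVP.rep_eq (hx V) (hy V)
      rw [dotProduct, Fin.sum_univ_three, h0, h1]
      -- Homogenization: the form at `P.rep` is `P.rep 2` times the affine form at `(a V, b V)`.
      linear_combination P.rep 2 * hline V hV
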